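/- Let $f_1(x_1,x_2,x_3)=-9x_1^2+2x_1x_2+7x_2^2+2x_3^2$ and let $X$ be the affine quadric $f_1(x)=1$. Then $f_1$ represents $1$ over $\mathbf R$ and over $\mathbf Z_p$ for every prime $p$, but $f_1$ does not represent $1$ over $\mathbf Z$. For every prime $p$ the limit $$\mu_p(X)=\lim_{k\to\infty}\frac{\#X(\mathbf Z/p^k\mathbf Z)}{(p^k)^2}$$ exists, and the product $\mathfrak S(X)=\prod_p\mu_p(X)$, taken over the primes in increasing order, converges, in the sense that its partial products have a finite limit $\mathfrak S(X)$. Moreover, let $|\cdot|$ be any Euclidean norm on $\mathbf R^3$ (that is, $|x|=\sqrt{Q(x)}$ with $Q$ a positive definite real quadratic form), and put $N(T,X)=\#\{x\in X(\mathbf Z):|x|\le T\}$ for $T>0$. Then $N(T,X)=0$ for all $T>0$; for every $T>0$ the limit $$\mu_\infty(T,X)=\lim_{\varepsilon\to0^+}\frac{\mathrm{Vol}\{x\in\mathbf R^3:|x|\le T,\ |f_1(x)-1|<\varepsilon/2\}}{\varepsilon}$$ exists; and $\mathfrak S(X)\,\mu_\infty(T,X)\to\infty$ as $T\to\infty$.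 Consequently $c_X=0$, where $c_X$ is the constant defined by $N(T,X)\sim c_X\,\mathfrak S(X)\mu_\infty(T,X)$ as $T\to\infty$: that is, a real number $c$ satisfies $N(T,X)=(c+o(1))\,\mathfrak S(X)\mu_\infty(T,X)$ as $T\to\infty$ if and only if $c=0$. -/

import Mathlib

open Filter Topology MeasureTheory Asymptotics

namespace TernaryQuadric

/-- The value `f(x) = ∑ i j, a_ij x_i x_j` of the integral-matrix ternary quadratic form with
matrix `A`, at a vector `x` with coordinates in a commutative ring `R`. -/
def form {R : Type*} [CommRing R] (A : Matrix (Fin 3) (Fin 3) ℤ) (x : Fin 3 → R) : R :=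
  ∑ i, ∑ j, (A i j : R) * x i * x j

/-- The set `X(R)` of `R`-points of the affine quadric `X : f(x) = q`. -/
def points (A : Matrix (Fin 3) (Fin 3) ℤ) (q : ℤ) (R : Type*) [CommRing R] : Set (Fin 3 → R) :=
  {x | form A x = (q : R)}

/-- The form represents `q` over `R`. -/
def Represents (A : Matrix (Fin 3) (Fin 3) ℤ) (q : ℤ) (R : Type*) [CommRing R] : Prop :=
  ∃ x : Fin 3 → R, form A x = (q : R)

/-- The Euclidean norm `|x| = √(Q x)` on `ℝ³` attached to a (positive definite) quadratic
form `Q`. -/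
noncomputable def euclNorm (Q : QuadraticForm ℝ (Fin 3 → ℝ)) (x : Fin 3 → ℝ) : ℝ :=
  √(Q x)

/-- The counting function `N(T, X) = #{x ∈ X(ℤ) : |x| ≤ T}`. -/
noncomputable def countingFunction (A : Matrix (Fin 3) (Fin 3) ℤ) (q : ℤ)
    (Q : QuadraticForm ℝ (Fin 3 → ℝ)) (T : ℝ) : ℕ :=
  {x : Fin 3 → ℤ | x ∈ points A q ℤ ∧ euclNorm Q (fun i => (x i : ℝ)) ≤ T}.ncard

/-- `#X(ℤ/p^k) / (p^k)^2`. -/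
noncomputable def densityRatio (A : Matrix (Fin 3) (Fin 3) ℤ) (q : ℤ) (p k : ℕ) : ℝ :=
  (Nat.card (points A q (ZMod (p ^ k))) : ℝ) / ((p : ℝ) ^ k) ^ 2

/-- The local density `μ_p(X) = lim_k #X(ℤ/p^k) / (p^k)^2`. -/
noncomputable def localDensity (A : Matrix (Fin 3) (Fin 3) ℤ) (q : ℤ) (p : ℕ) : ℝ :=
  limUnder atTop (fun k : ℕ => densityRatio A q p k)

/-- The product of `μ_p(X)` over the primes `p < n`. -/
noncomputable def partialSeries (A : Matrix (Fin 3) (Fin 3) ℤ) (q : ℤ) (n : ℕ) : ℝ :=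
  ∏ p ∈ Nat.primesBelow n, localDensity A q p

/-- The singular series `𝔖(X) = ∏_p μ_p(X)`, a conditionally convergent product over the primes
in increasing order. -/
noncomputable def singularSeries (A : Matrix (Fin 3) (Fin 3) ℤ) (q : ℤ) : ℝ :=
  limUnder atTop (partialSeries A q)

/-- `Vol {x ∈ ℝ³ : |x| ≤ T, |f(x) - q| < ε/2} / ε`. -/
noncomputable def volumeRatio (A : Matrix (Fin 3) (Fin 3) ℤ) (q : ℤ)
    (Q : QuadraticForm ℝ (Fin 3 → ℝ)) (T ε : ℝ) : ℝ :=
  volume.real {x : Fin 3 → ℝ | euclNorm Q x ≤ T ∧ |form A x - (q : ℝ)| < ε / 2} / ε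

/-- The singular integral `μ_∞(T, X)`, the limit of `volumeRatio` as `ε → 0`, `ε > 0`. -/
noncomputable def singularIntegral (A : Matrix (Fin 3) (Fin 3) ℤ) (q : ℤ)
    (Q : QuadraticForm ℝ (Fin 3 → ℝ)) (T : ℝ) : ℝ :=
  limUnder (𝓝[>] (0 : ℝ)) (fun ε => volumeRatio A q Q T ε)

/-- `N(T, X) ∼ c 𝔖(X) μ_∞(T, X)` as `T → ∞`, in the form
`N(T, X) = (c + o(1)) 𝔖(X) μ_∞(T, X)`, which makes sense for `c = 0` as well. -/
def IsAsymptoticConstant (A : Matrix (Fin 3) (Fin 3) ℤ) (q : ℤ)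
    (Q : QuadraticForm ℝ (Fin 3 → ℝ)) (c : ℝ) : Prop :=
  (fun T : ℝ => (countingFunction A q Q T : ℝ)
      - c * (singularSeries A q * singularIntegral A q Q T))
    =o[atTop] (fun T : ℝ => singularSeries A q * singularIntegral A q Q T)

/-- The matrix of `f₁`. -/
def f₁ : Matrix (Fin 3) (Fin 3) ℤ :=
  !![-9, 1, 0;
      1, 7, 0;
      0, 0, 2]

theorem form_f₁ {R : Type*} [CommRing R] (x : Fin 3 → R) :
    form f₁ x = -9 * x 0 ^ 2 + 2 * x 0 * x 1 + 7 * x 1 ^ 2 + 2 * x 2 ^ 2 := by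
  simp [form, f₁, Fin.sum_univ_three]
  ring

end TernaryQuadric

/-!
With `u = y - x` and `v = 9 x + 7 y` the form becomes `f₁ = u v + 2 z²`.

*Integral points.* Since `v = 7 u + 16 x`, an integral point satisfies `7 u² + 16 u x + 2 z² = 1`.
Then `u` divides `2 z² - 1`, so every prime factor of `u` has `2` as a quadratic residue and
`u ≡ ±1` modulo `8`. Hence `u² ≡ 1` modulo `16`, which leaves `z² ≡ 5` modulo `8`, a contradiction
(`not_represents_f₁_int`). Thus the counting function vanishes identically.

*Local densities.* For odd `p` the substitution is invertible over `ℤ/p^k`, and counting the points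
of `u v + 2 z² = 1` according to whether `u` is a unit gives the density `1 + χ₈(p) / p`
(`densityRatio_f₁_of_odd`). At `p = 2` the points modulo `2 ^ k`, `k ≥ 4`, are governed by the
congruence `7 u² + 2 z² ≡ 1` modulo `16`, and the density is `2` (`densityRatio_f₁_two`).

*Singular series.* The product `∏ (1 + χ₈(p) / p)` converges only conditionally. As `L(1, χ₈) > 0`,
the argument of Mertens bounds `∑_{n ≤ N} χ₈(n) Λ(n) / n`
(`exists_abs_sum_chi_mul_vonMangoldt_div_le`). Dirichlet's test with the weights `1 / log p` then
shows that `∑ χ₈(p) / p` converges, so the product has a positive limit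
(`exists_pos_tendsto_prod_one_add_chi_div`).

*Singular integral.* Let `h(c)` be the volume of the cone `{0 < f₁ ≤ 1, Q ≤ c f₁}`. Both forms are
homogeneous of degree `2`, so `{a < f₁ ≤ b, Q ≤ c f₁}` has volume `(b^{3/2} - a^{3/2}) h(c)`. The
thin slab defining `volumeRatio` lies between two such regions, with `c = T² / (1 ± ε / 2)`
(`volumeRatio_mem_Icc`), and `h` is continuous because the cone `Q = c f₁` is null. Hence the
limit is `(3 / 2) h(T²)` (`tendsto_volumeRatio`). It tends to infinity with `T` because
`{0 < f₁ ≤ 1}` has infinite volume: the unimodular isometry `(u, v, z) ↦ (2 u, v / 2, z)` carries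
infinitely many pieces of it onto one another (`volume_realForm_mem_Ioc`).
-/

namespace TernaryQuadric

/-! ### Points over `ℝ`, `ℤ_[p]` and `ℤ` -/

/-- The hyperbolic shape of `f₁`. -/
theorem form_f₁_eq {R : Type*} [CommRing R] (x : Fin 3 → R) :
    form f₁ x = (x 1 - x 0) * (9 * x 0 + 7 * x 1) + 2 * x 2 ^ 2 := by
  rw [form_f₁]
  ring

theorem represents_f₁_real : Represents f₁ 1 ℝ := by
  refine ⟨![0, 0, √(1 / 2)], ?_⟩
  rw [form_f₁_eq]
  have : √(1 / 2) ^ 2 = (1 / 2 : ℝ) := Real.sq_sqrt (by norm_num)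
  simp only [Matrix.cons_val_zero, Matrix.cons_val_one, Matrix.cons_val, this]
  norm_num

/-- For odd `p` the rational point `(-3/8, 5/8, 0)` is `p`-integral, while `(-4/3, 5/3, 1)` is
`2`-integral. -/
theorem represents_f₁_padicInt (p : ℕ) [hp : Fact p.Prime] : Represents f₁ 1 ℤ_[p] := by
  have unit_inv : ∀ n : ℕ, p.Coprime n → ∃ c : ℤ_[p], (n : ℤ_[p]) * c = 1 := by
    intro n hn
    have h : IsUnit (n : ℤ_[p]) := by
      rw [PadicInt.isUnit_iff]
      exact PadicInt.norm_natCast_eq_one_iff.2 hn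
    exact h.exists_right_inv
  by_cases h2 : p = 2
  · obtain ⟨c, hc⟩ := unit_inv 3 (by rw [h2]; norm_num)
    refine ⟨![-4 * c, 5 * c, 1], ?_⟩
    rw [form_f₁_eq]
    push_cast at hc
    simp only [Matrix.cons_val_zero, Matrix.cons_val_one, Matrix.cons_val]
    linear_combination (-3 * c - 1) * hc
  · obtain ⟨c, hc⟩ := unit_inv (2 ^ 3)
      (((Nat.coprime_primes hp.out Nat.prime_two).2 h2).pow_right 3)
    refine ⟨![-3 * c, 5 * c, 0], ?_⟩
    rw [form_f₁_eq]
    push_cast at hc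
    simp only [Matrix.cons_val_zero, Matrix.cons_val_one, Matrix.cons_val]
    linear_combination (8 * c + 1) * hc

/-- Every divisor of `2 z² - 1` is `±1` modulo `8`, since `2` is a square modulo each of its
prime factors. -/
theorem emod_eight_of_dvd_two_mul_sq_sub_one {z : ℤ} (n : ℕ) (h : (n : ℤ) ∣ 2 * z ^ 2 - 1) :
    n % 8 = 1 ∨ n % 8 = 7 := by
  induction n using Nat.recOnMul with
  | zero =>
    exfalso
    have := zero_dvd_iff.1 h
    omega
  | one => simp
  | prime p hp =>
    have := Fact.mk hp
    have hp2 : p ≠ 2 := by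
      rintro rfl
      push_cast at h
      omega
    rw [← ZMod.exists_sq_eq_two_iff hp2]
    have h0 : (2 : ZMod p) * (z : ZMod p) ^ 2 - 1 = 0 := by
      have := (ZMod.intCast_zmod_eq_zero_iff_dvd _ p).2 h
      exact_mod_cast this
    exact ⟨2 * z, by linear_combination (-2) * h0⟩
  | mul a b ha hb =>
    push_cast at h
    have h1 := ha ((Dvd.intro _ rfl).trans h)
    have h2 := hb ((Dvd.intro_left _ rfl).trans h)
    rcases h1 with h1 | h1 <;> rcases h2 with h2 | h2 <;> simp [Nat.mul_mod, h1, h2]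

/-- With `u = y - x` an integral point satisfies `7 u² + 16 u x + 2 z² = 1`. Then `u ∣ 2 z² - 1`
forces `u ≡ ±1` modulo `8`, hence `u² ≡ 1` modulo `16` and `z² ≡ 5` modulo `8`, which is absurd. -/
theorem not_represents_f₁_int : ¬ Represents f₁ 1 ℤ := by
  rintro ⟨x, hx⟩
  rw [form_f₁_eq, Int.cast_one] at hx
  obtain ⟨u, hu⟩ : ∃ u, u = x 1 - x 0 := ⟨_, rfl⟩
  have hx' : u * (7 * u + 16 * x 0) + 2 * x 2 ^ 2 = 1 := by
    rw [← hx, hu]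
    ring
  have hdvd : ((u.natAbs : ℕ) : ℤ) ∣ 2 * x 2 ^ 2 - 1 := by
    rw [Int.natAbs_dvd]
    exact ⟨-(7 * u + 16 * x 0), by linear_combination hx'⟩
  have hmod := emod_eight_of_dvd_two_mul_sq_sub_one _ hdvd
  have hu2 : u ^ 2 % 16 = 1 := by
    have h8 : u % 16 = 1 ∨ u % 16 = 7 ∨ u % 16 = 9 ∨ u % 16 = 15 := by omega
    rcases h8 with h | h | h | h <;> simp [pow_two, Int.mul_emod, h]
  have hz : x 2 ^ 2 % 8 = 0 ∨ x 2 ^ 2 % 8 = 1 ∨ x 2 ^ 2 % 8 = 4 := by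
    have : x 2 % 8 = 0 ∨ x 2 % 8 = 1 ∨ x 2 % 8 = 2 ∨ x 2 % 8 = 3 ∨ x 2 % 8 = 4 ∨ x 2 % 8 = 5 ∨
      x 2 % 8 = 6 ∨ x 2 % 8 = 7 := by omega
    rcases this with h | h | h | h | h | h | h | h <;> simp [pow_two, Int.mul_emod, h]
  have hlin : 7 * u ^ 2 + 16 * (u * x 0) + 2 * x 2 ^ 2 = 1 := by linear_combination hx'
  omega

theorem countingFunction_f₁ (Q : QuadraticForm ℝ (Fin 3 → ℝ)) (T : ℝ) :
    countingFunction f₁ 1 Q T = 0 := by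
  have : {x : Fin 3 → ℤ | x ∈ points f₁ 1 ℤ ∧ euclNorm Q (fun i => (x i : ℝ)) ≤ T} = ∅ :=
    Set.eq_empty_of_forall_notMem fun x hx => not_represents_f₁_int ⟨x, hx.1⟩
  rw [countingFunction, this, Set.ncard_empty]


/-! ### Conditional convergence of `∏ (1 + χ₈(p) / p)` -/

/-- Abel's inequality: partial sums of `z` bounded by `B` and antitone nonnegative weights `g`. -/
theorem abs_sum_Ico_mul_le_of_antitone {g z : ℕ → ℝ} {m : ℕ} {B : ℝ}
    (hg : ∀ n, m ≤ n → g (n + 1) ≤ g n) (hg0 : ∀ n, m ≤ n → 0 ≤ g n)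
    (hz : ∀ n, |∑ i ∈ Finset.Ico m n, z i| ≤ B) {n : ℕ} (hmn : m ≤ n) :
    |∑ i ∈ Finset.Ico m n, g i * z i| ≤ B * g m := by
  have key : |∑ i ∈ Finset.Ico m n, g i * z i - g n * ∑ i ∈ Finset.Ico m n, z i|
      ≤ B * (g m - g n) := by
    induction n, hmn using Nat.le_induction with
    | base => simp
    | succ n hmn ih =>
      have h1 : ∑ i ∈ Finset.Ico m (n + 1), g i * z i
          - g (n + 1) * ∑ i ∈ Finset.Ico m (n + 1), z i
          = (∑ i ∈ Finset.Ico m n, g i * z i - g n * ∑ i ∈ Finset.Ico m n, z i)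
            + (g n - g (n + 1)) * ∑ i ∈ Finset.Ico m (n + 1), z i := by
        rw [Finset.sum_Ico_succ_top hmn, Finset.sum_Ico_succ_top hmn]
        ring
      rw [h1]
      refine (abs_add_le _ _).trans ?_
      rw [abs_mul, abs_of_nonneg (sub_nonneg.2 (hg n hmn))]
      have h2 := mul_le_mul_of_nonneg_left (hz (n + 1)) (sub_nonneg.2 (hg n hmn))
      linarith
  have h3 : |g n * ∑ i ∈ Finset.Ico m n, z i| ≤ g n * B := by
    rw [abs_mul, abs_of_nonneg (hg0 n hmn)]
    exact mul_le_mul_of_nonneg_left (hz n) (hg0 n hmn)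
  have h4 := abs_add_le (∑ i ∈ Finset.Ico m n, g i * z i - g n * ∑ i ∈ Finset.Ico m n, z i)
    (g n * ∑ i ∈ Finset.Ico m n, z i)
  rw [sub_add_cancel] at h4
  linarith

/-- The real-valued quadratic character modulo `8`, `n ↦ (2 / n)` for odd `n`. -/
noncomputable def chi (n : ℕ) : ℝ := (ZMod.χ₈ n : ℤ)

theorem chi_eq (n : ℕ) :
    chi n = if n % 2 = 0 then 0 else if n % 8 = 1 ∨ n % 8 = 7 then 1 else -1 := by
  rw [chi, ZMod.χ₈_nat_eq_if_mod_eight]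
  split_ifs <;> simp

theorem chi_mul (m n : ℕ) : chi (m * n) = chi m * chi n := by
  rw [chi, Nat.cast_mul, map_mul, Int.cast_mul, chi, chi]

theorem abs_chi_le_one (n : ℕ) : |chi n| ≤ 1 := by
  rw [chi_eq]
  split_ifs <;> simp

theorem sum_range_chi (n : ℕ) : ∑ i ∈ Finset.range n, chi i =
    if n % 8 = 2 ∨ n % 8 = 3 then 1 else if n % 8 = 6 ∨ n % 8 = 7 then -1 else 0 := by
  induction n with
  | zero => simp
  | succ n ih =>
    rw [Finset.sum_range_succ, ih, chi_eq]
    have : n % 8 < 8 := Nat.mod_lt _ (by norm_num)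
    split_ifs <;> first | (exfalso; omega) | norm_num

theorem abs_sum_Ico_chi_le_two (m n : ℕ) : |∑ i ∈ Finset.Ico m n, chi i| ≤ 2 := by
  rcases le_total m n with h | h
  · rw [Finset.sum_Ico_eq_sub _ h, sum_range_chi, sum_range_chi]
    split_ifs <;> norm_num
  · simp [Finset.Ico_eq_empty_of_le h]

theorem Ioc_zero_eq_Ico (N : ℕ) : Finset.Ioc 0 N = Finset.Ico 1 (N + 1) := by
  ext i
  simp only [Finset.mem_Ioc, Finset.mem_Ico]
  omega

theorem antitone_one_div_nat {m : ℕ} (hm : 1 ≤ m) (n : ℕ) (hn : m ≤ n) :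
    1 / ((n + 1 : ℕ) : ℝ) ≤ 1 / (n : ℝ) := by
  have : (0 : ℝ) < n := by exact_mod_cast (by omega : 0 < n)
  exact one_div_le_one_div_of_le this (by push_cast; linarith)

theorem abs_sum_Ico_chi_div_le {B : ℝ} {m n : ℕ} (hm : 1 ≤ m)
    (hB : ∀ n, |∑ i ∈ Finset.Ico m n, chi i| ≤ B) (hmn : m ≤ n) :
    |∑ i ∈ Finset.Ico m n, chi i / i| ≤ B / m := by
  have := abs_sum_Ico_mul_le_of_antitone (g := fun n : ℕ => 1 / (n : ℝ))
    (antitone_one_div_nat hm) (fun _ _ => by positivity) hB hmn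
  simpa [div_eq_mul_inv, mul_comm] using this

/-- The partial sums of `L(1, χ₈)` converge to a positive limit, with error at most `2 / (N + 1)`. -/
theorem exists_pos_abs_sum_chi_div_sub_le : ∃ L : ℝ, 0 < L ∧
    ∀ N : ℕ, |∑ i ∈ Finset.Ioc 0 N, chi i / i - L| ≤ 2 / (N + 1) := by
  set S : ℕ → ℝ := fun N => ∑ i ∈ Finset.Ioc 0 N, chi i / i with hS
  have hdiff : ∀ {B : ℝ} {M N : ℕ}, (∀ n, |∑ i ∈ Finset.Ico (M + 1) n, chi i| ≤ B) → M ≤ N →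
      |S N - S M| ≤ B / (M + 1) := by
    intro B M N hB hMN
    have : S N - S M = ∑ i ∈ Finset.Ico (M + 1) (N + 1), chi i / i := by
      simp only [hS, Ioc_zero_eq_Ico]
      rw [sub_eq_iff_eq_add', Finset.sum_Ico_consecutive _ (by omega) (by omega)]
    rw [this]
    simpa using abs_sum_Ico_chi_div_le (by omega) hB (by omega : M + 1 ≤ N + 1)
  have hcauchy : CauchySeq S := by
    rw [Metric.cauchySeq_iff']
    intro ε hε
    obtain ⟨M, hM⟩ := exists_nat_gt (2 / ε)
    refine ⟨M, fun n hn => ?_⟩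
    rw [Real.dist_eq]
    refine (hdiff (abs_sum_Ico_chi_le_two _) hn).trans_lt ?_
    rw [div_lt_iff₀ (by positivity)]
    rw [div_lt_iff₀ hε] at hM
    nlinarith
  obtain ⟨L, hL⟩ := cauchySeq_tendsto_of_complete hcauchy
  have hlim : ∀ {B : ℝ} {M : ℕ}, (∀ n, |∑ i ∈ Finset.Ico (M + 1) n, chi i| ≤ B) →
      |S M - L| ≤ B / (M + 1) := by
    intro B M hB
    rw [abs_sub_comm]
    refine le_of_tendsto ((hL.sub_const (S M)).abs) ?_
    filter_upwards [eventually_ge_atTop M] with N hN using hdiff hB hN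
  refine ⟨L, ?_, fun N => hlim (abs_sum_Ico_chi_le_two _)⟩
  -- From `9` on, a full period of `χ₈`, the partial sums of `χ₈` lie in `{0, 1, -1}`, so the tail
  -- is at most `1 / 9`, less than the sum `1 - 1/3 - 1/5 + 1/7` of the first period.
  have h8 : |S 8 - L| ≤ 1 / ((8 : ℕ) + 1) := by
    refine hlim fun n => ?_
    rcases le_total 9 n with h | h
    · rw [Finset.sum_Ico_eq_sub _ h, sum_range_chi, sum_range_chi]
      norm_num
      split_ifs <;> norm_num
    · rw [Finset.Ico_eq_empty_of_le h]
      simp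
  have hS8 : S 8 = 64 / 105 := by
    simp only [hS, Ioc_zero_eq_Ico]
    norm_num [Finset.sum_Ico_eq_sum_range, Finset.sum_range_succ, chi_eq]
  rw [hS8, abs_le] at h8
  have := h8.2
  norm_num at this
  linarith

theorem exists_abs_sum_chi_mul_log_div_le : ∃ C : ℝ, ∀ N : ℕ,
    |∑ i ∈ Finset.Ioc 0 N, chi i * Real.log i / i| ≤ C := by
  -- `log x / x` decreases only beyond `e`, hence the split at `3`
  refine ⟨2 * (Real.log 3 / 3) + 1, fun N => ?_⟩
  rcases le_or_gt N 1 with h | h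
  · have : ∑ i ∈ Finset.Ioc 0 N, chi i * Real.log i / i = 0 := by
      refine Finset.sum_eq_zero fun i hi => ?_
      have : i = 1 := by simp only [Finset.mem_Ioc] at hi; omega
      simp [this]
    rw [this, abs_zero]
    have := Real.log_nonneg (by norm_num : (1 : ℝ) ≤ 3)
    positivity
  · have h1 : ∑ i ∈ Finset.Ioc 0 N, chi i * Real.log i / i
        = ∑ i ∈ Finset.Ico 3 (N + 1), (Real.log i / i) * chi i := by
      rw [Ioc_zero_eq_Ico, ← Finset.sum_Ico_consecutive _ (by norm_num : 1 ≤ 3) (by omega)]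
      have : ∑ i ∈ Finset.Ico 1 3, chi i * Real.log i / i = 0 := by
        norm_num [Finset.sum_Ico_eq_sum_range, Finset.sum_range_succ, chi_eq]
      rw [this, zero_add]
      exact Finset.sum_congr rfl fun i _ => by ring
    rw [h1]
    have h2 := abs_sum_Ico_mul_le_of_antitone (g := fun n : ℕ => Real.log n / n) (m := 3)
      (n := N + 1) (B := 2) (z := chi) ?_ ?_ (abs_sum_Ico_chi_le_two 3) (by omega)
    · push_cast at h2 ⊢
      linarith
    · intro n hn
      have h3 : (3 : ℝ) ≤ n := by exact_mod_cast hn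
      have he := Real.exp_one_lt_d9
      refine Real.log_div_self_antitoneOn ?_ ?_ (by push_cast; linarith)
      · change Real.exp 1 ≤ (n : ℝ)
        linarith
      · change Real.exp 1 ≤ ((n + 1 : ℕ) : ℝ)
        push_cast
        linarith
    · intro n hn
      have : (1 : ℝ) ≤ n := by exact_mod_cast (by omega : 1 ≤ n)
      have := Real.log_nonneg this
      positivity

/-- Mertens' theorem for `χ₈`: since `log = Λ * 1`, the sum `∑ χ₈(n) log n / n` is
`∑_d χ₈(d) Λ(d) / d ∑_{m ≤ N / d} χ₈(m) / m`, whose inner sum is `L(1, χ₈) + O(d / N)`. By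
Chebyshev's bound the error terms contribute `O(1)`, and `L(1, χ₈) ≠ 0` can be divided out. -/
theorem exists_abs_sum_chi_mul_vonMangoldt_div_le : ∃ C : ℝ, ∀ N : ℕ,
    |∑ i ∈ Finset.Ioc 0 N, chi i * ArithmeticFunction.vonMangoldt i / i| ≤ C := by
  obtain ⟨L, hL, hLN⟩ := exists_pos_abs_sum_chi_div_sub_le
  obtain ⟨C, hC⟩ := exists_abs_sum_chi_mul_log_div_le
  refine ⟨(C + 2 * (Real.log 4 + 4)) / L, fun N => ?_⟩
  rcases Nat.eq_zero_or_pos N with rfl | hN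
  · have h0 := (abs_nonneg _).trans (hC 0)
    have := Real.log_nonneg (by norm_num : (1 : ℝ) ≤ 4)
    simp only [Finset.Ioc_self, Finset.sum_empty, abs_zero]
    positivity
  let f : ArithmeticFunction ℝ := ⟨fun n => chi n * ArithmeticFunction.vonMangoldt n / n, by simp⟩
  let g : ArithmeticFunction ℝ := ⟨fun n => chi n / n, by simp⟩
  have hfg : ∀ n, 0 < n → (f * g) n = chi n * Real.log n / n := by
    intro n hn
    have hlog := Nat.sum_divisorsAntidiagonal (n := n)
      (fun d _ => (ArithmeticFunction.vonMangoldt d : ℝ))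
    rw [ArithmeticFunction.vonMangoldt_sum] at hlog
    rw [ArithmeticFunction.mul_apply, ← hlog, Finset.mul_sum, Finset.sum_div]
    refine Finset.sum_congr rfl fun x hx => ?_
    obtain ⟨hx1, -⟩ := Nat.mem_divisorsAntidiagonal.1 hx
    have h1 : (x.1 : ℝ) ≠ 0 := by
      rintro h; norm_cast at h; simp [h] at hx1; omega
    have h2 : (x.2 : ℝ) ≠ 0 := by
      rintro h; norm_cast at h; simp [h] at hx1; omega
    simp only [f, g, ArithmeticFunction.coe_mk]
    rw [← hx1, chi_mul, Nat.cast_mul]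
    field_simp
  have hsum : ∑ n ∈ Finset.Ioc 0 N, chi n * Real.log n / n
      = ∑ d ∈ Finset.Ioc 0 N, f d * ∑ m ∈ Finset.Ioc 0 (N / d), g m := by
    rw [← ArithmeticFunction.sum_Ioc_mul_eq_sum_sum]
    exact Finset.sum_congr rfl fun n hn => (hfg n (Finset.mem_Ioc.1 hn).1).symm
  have hNpos : (0 : ℝ) < N := by exact_mod_cast hN
  have herr : |∑ d ∈ Finset.Ioc 0 N, f d * (∑ m ∈ Finset.Ioc 0 (N / d), g m - L)|
      ≤ 2 * (Real.log 4 + 4) := by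
    have hterm : ∀ d ∈ Finset.Ioc 0 N, |f d * (∑ m ∈ Finset.Ioc 0 (N / d), g m - L)|
        ≤ 2 / N * ArithmeticFunction.vonMangoldt d := by
      intro d hd
      have hd0 : 0 < d := (Finset.mem_Ioc.1 hd).1
      have hd1 : (0 : ℝ) < d := by exact_mod_cast hd0
      have h1 : |f d| ≤ ArithmeticFunction.vonMangoldt d / d := by
        simp only [f, ArithmeticFunction.coe_mk]
        rw [abs_div, abs_mul, abs_of_nonneg ArithmeticFunction.vonMangoldt_nonneg,
          abs_of_pos hd1]
        gcongr
        exact mul_le_of_le_one_left ArithmeticFunction.vonMangoldt_nonneg (abs_chi_le_one d)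
      have h2 : |∑ m ∈ Finset.Ioc 0 (N / d), g m - L| ≤ 2 * d / N := by
        refine (hLN (N / d)).trans ?_
        have h3 : (N : ℝ) < d * ((N / d : ℕ) + 1) := by
          exact_mod_cast Nat.lt_mul_div_succ N hd0
        rw [div_le_div_iff₀ (by positivity) hNpos]
        nlinarith
      rw [abs_mul]
      refine (mul_le_mul h1 h2 (abs_nonneg _) (by positivity)).trans_eq ?_
      field_simp
    refine (Finset.abs_sum_le_sum_abs _ _).trans ((Finset.sum_le_sum hterm).trans ?_)
    rw [← Finset.mul_sum]
    have hpsi := Chebyshev.psi_le_const_mul_self (x := (N : ℝ)) hNpos.le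
    rw [Chebyshev.psi, Nat.floor_natCast] at hpsi
    refine (mul_le_mul_of_nonneg_left hpsi (by positivity)).trans_eq ?_
    field_simp
  have hdecomp : L * ∑ d ∈ Finset.Ioc 0 N, f d = ∑ n ∈ Finset.Ioc 0 N, chi n * Real.log n / n
      - ∑ d ∈ Finset.Ioc 0 N, f d * (∑ m ∈ Finset.Ioc 0 (N / d), g m - L) := by
    rw [hsum, ← Finset.sum_sub_distrib, Finset.mul_sum]
    exact Finset.sum_congr rfl fun d _ => by ring
  change |∑ d ∈ Finset.Ioc 0 N, f d| ≤ _
  have hLf : |L * ∑ d ∈ Finset.Ioc 0 N, f d| = |∑ d ∈ Finset.Ioc 0 N, f d| * L := by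
    rw [abs_mul, abs_of_pos hL, mul_comm]
  rw [le_div_iff₀ hL, ← hLf, hdecomp]
  refine (abs_sub _ _).trans (add_le_add (hC N) herr)

/-- The terms of `∑ Λ(n) / n` at proper prime powers contribute a convergent series. -/
theorem exists_sum_not_prime_vonMangoldt_div_le : ∃ C : ℝ, ∀ N : ℕ,
    ∑ i ∈ Finset.range N, (if i.Prime then 0 else ArithmeticFunction.vonMangoldt i) / (i : ℝ)
      ≤ C := by
  have h := ArithmeticFunction.vonMangoldt.summable_residueClass_non_primes_div (q := 1) 0
  have h1 : ∀ n : ℕ, ArithmeticFunction.vonMangoldt.residueClass (0 : ZMod 1) n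
      = ArithmeticFunction.vonMangoldt n := by
    intro n
    rw [ArithmeticFunction.vonMangoldt.residueClass, Set.indicator_of_mem]
    exact Subsingleton.elim _ _
  simp only [h1] at h
  refine ⟨_, fun N => h.sum_le_tsum _ fun i _ => ?_⟩
  have := ArithmeticFunction.vonMangoldt_nonneg (n := i)
  split_ifs <;> positivity

theorem exists_tendsto_sum_prime_chi_div : ∃ l : ℝ,
    Tendsto (fun n => ∑ p ∈ Nat.primesBelow n, chi p / p) atTop (𝓝 l) := by
  obtain ⟨C₁, h₁⟩ := exists_abs_sum_chi_mul_vonMangoldt_div_le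
  obtain ⟨C₂, h₂⟩ := exists_sum_not_prime_vonMangoldt_div_le
  let z : ℕ → ℝ := fun i => if i.Prime then chi i * ArithmeticFunction.vonMangoldt i / i else 0
  have hz : ∀ n, ‖∑ i ∈ Finset.range n, z i‖ ≤ C₁ + C₂ := by
    intro n
    have e : ∑ i ∈ Finset.range n, z i
        = ∑ i ∈ Finset.range n, chi i * ArithmeticFunction.vonMangoldt i / i
          - ∑ i ∈ Finset.range n,
            chi i * ((if i.Prime then 0 else ArithmeticFunction.vonMangoldt i) / (i : ℝ)) := by
      rw [← Finset.sum_sub_distrib]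
      refine Finset.sum_congr rfl fun i _ => ?_
      simp only [z]
      split_ifs <;> ring
    rw [e, Real.norm_eq_abs]
    refine (abs_sub _ _).trans (add_le_add ?_ ?_)
    · rcases n with _ | n
      · simpa using h₁ 0
      · rw [Finset.range_eq_Ico, Finset.sum_eq_sum_Ico_succ_bot (by omega)]
        simpa [Ioc_zero_eq_Ico] using h₁ n
    · refine (Finset.abs_sum_le_sum_abs _ _).trans ((Finset.sum_le_sum fun i _ => ?_).trans (h₂ n))
      have h0 : 0 ≤ (if i.Prime then 0 else ArithmeticFunction.vonMangoldt i) / (i : ℝ) := by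
        have := ArithmeticFunction.vonMangoldt_nonneg (n := i)
        split_ifs <;> positivity
      rw [abs_mul, abs_of_nonneg h0]
      exact mul_le_of_le_one_left h0 (abs_chi_le_one i)
  -- `max n 2` keeps the logarithm positive; primes are not affected
  let f : ℕ → ℝ := fun n => 1 / Real.log ((max n 2 : ℕ) : ℝ)
  have hlog : ∀ n : ℕ, 0 < Real.log ((max n 2 : ℕ) : ℝ) := fun n =>
    Real.log_pos (by exact_mod_cast (by omega : 1 < max n 2))
  have hf : Antitone f := by
    intro m n hmn
    refine one_div_le_one_div_of_le (hlog m) (Real.log_le_log ?_ ?_)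
    · exact_mod_cast (by omega : 0 < max m 2)
    · exact_mod_cast (by omega : max m 2 ≤ max n 2)
  have hf0 : Tendsto f atTop (𝓝 0) := by
    have h : Tendsto (fun n : ℕ => Real.log ((max n 2 : ℕ) : ℝ)) atTop atTop :=
      Real.tendsto_log_atTop.comp (tendsto_natCast_atTop_atTop.comp
        (tendsto_atTop_mono (fun n => le_max_left n 2) tendsto_id))
    exact tendsto_const_nhds.div_atTop h
  obtain ⟨l, hl⟩ := cauchySeq_tendsto_of_complete
    (hf.cauchySeq_series_mul_of_tendsto_zero_of_bounded hf0 hz)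
  refine ⟨l, hl.congr fun n => ?_⟩
  rw [Nat.primesBelow, Finset.sum_filter]
  refine Finset.sum_congr rfl fun i _ => ?_
  by_cases hi : i.Prime
  · have := (hlog i).ne'
    simp only [f, z, hi, if_true, smul_eq_mul, ArithmeticFunction.vonMangoldt_apply_prime hi,
      max_eq_left hi.two_le] at this ⊢
    field_simp
  · simp [z, hi]

theorem abs_log_one_add_sub_le {x : ℝ} (hx : |x| ≤ 1 / 2) : |Real.log (1 + x) - x| ≤ 2 * x ^ 2 := by
  have hx' : |-x| < 1 := by rw [abs_neg]; linarith
  have h := Real.abs_log_sub_add_sum_range_le hx' 1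
  norm_num at h
  have e : |Real.log (1 + x) - x| = |-x + Real.log (1 + x)| := by ring_nf
  rw [e]
  refine h.trans ?_
  rw [div_le_iff₀ (by linarith)]
  nlinarith [sq_nonneg x]

theorem chi_prime_div_abs_le {p : ℕ} (hp : p.Prime) : |chi p / p| ≤ 1 / 2 := by
  have h2 : (2 : ℝ) ≤ p := by exact_mod_cast hp.two_le
  rw [abs_div, abs_of_pos (by linarith : (0 : ℝ) < p), div_le_div_iff₀ (by linarith) (by norm_num)]
  nlinarith [abs_chi_le_one p]

theorem exists_pos_tendsto_prod_one_add_chi_div : ∃ l : ℝ, 0 < l ∧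
    Tendsto (fun n => ∏ p ∈ Nat.primesBelow n, (1 + chi p / p)) atTop (𝓝 l) := by
  obtain ⟨l, hl⟩ := exists_tendsto_sum_prime_chi_div
  let y : ℕ → ℝ := fun i => if i.Prime then Real.log (1 + chi i / i) - chi i / i else 0
  have hy : Summable y := by
    refine Summable.of_norm_bounded
      ((Real.summable_one_div_nat_pow.2 one_lt_two).mul_left 2) fun i => ?_
    simp only [y]
    split_ifs with hi
    · refine (abs_log_one_add_sub_le (chi_prime_div_abs_le hi)).trans ?_
      rw [div_pow]
      gcongr
      rw [← sq_abs]
      exact pow_le_one₀ (abs_nonneg _) (abs_chi_le_one i)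
    · simp only [norm_zero]; positivity
  refine ⟨Real.exp (l + ∑' i, y i), Real.exp_pos _, ?_⟩
  refine ((Real.continuous_exp.tendsto _).comp
    (hl.add hy.hasSum.tendsto_sum_nat)).congr fun n => ?_
  have e : ∑ i ∈ Finset.range n, y i
      = ∑ p ∈ Nat.primesBelow n, (Real.log (1 + chi p / p) - chi p / p) := by
    rw [Nat.primesBelow, Finset.sum_filter]
  simp only [Function.comp_apply]
  rw [e, ← Finset.sum_add_distrib, Real.exp_sum]
  refine Finset.prod_congr rfl fun p hp => ?_
  have := (abs_le.1 (chi_prime_div_abs_le (Nat.prime_of_mem_primesBelow hp))).1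
  rw [add_sub_cancel, Real.exp_log (by linarith)]


/-! ### The local densities at odd primes -/

/-- Reduction `ℤ/p^k → ℤ/p^l` for `l ≤ k`. -/
def reduction (p : ℕ) {l k : ℕ} (h : l ≤ k) : ZMod (p ^ k) →+* ZMod (p ^ l) :=
  ZMod.castHom (pow_dvd_pow p h) (ZMod (p ^ l))

theorem reduction_surjective {p l k : ℕ} (h : l ≤ k) : Function.Surjective (reduction p h) :=
  ZMod.ringHom_surjective _

section PrimePower

variable {p : ℕ} [hp : Fact p.Prime] {k : ℕ}

theorem reduction_eq_zero_iff {l : ℕ} (h : l ≤ k) {a : ZMod (p ^ k)} :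
    reduction p h a = 0 ↔ (p : ZMod (p ^ k)) ^ l ∣ a := by
  obtain ⟨n, rfl⟩ := ZMod.natCast_zmod_surjective a
  constructor
  · intro hn
    rw [map_natCast, ZMod.natCast_eq_zero_iff] at hn
    exact_mod_cast Nat.cast_dvd_cast (α := ZMod (p ^ k)) hn
  · rintro ⟨c, hc⟩
    rw [hc, map_mul, map_pow, map_natCast, ← Nat.cast_pow, ZMod.natCast_self, zero_mul]

theorem isUnit_iff_reduction_ne_zero (hk : 1 ≤ k) {a : ZMod (p ^ k)} :
    IsUnit a ↔ reduction p hk a ≠ 0 := by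
  obtain ⟨n, rfl⟩ := ZMod.natCast_zmod_surjective a
  rw [ZMod.isUnit_iff_coprime, Nat.coprime_pow_right_iff (by omega), Nat.coprime_comm,
    hp.out.coprime_iff_not_dvd, map_natCast, Ne, ZMod.natCast_eq_zero_iff, pow_one]

theorem isUnit_two_zmod_prime_pow (hp2 : p ≠ 2) : IsUnit (2 : ZMod (p ^ k)) := by
  have := (ZMod.isUnit_iff_coprime 2 (p ^ k)).2
    (((Nat.coprime_primes Nat.prime_two hp.out).2 hp2.symm).pow_right k)
  exact_mod_cast this

/-- Hensel's lemma for square roots: if `a ≡ b²` modulo `p` then `a ^ (p ^ (k - 1))`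
and `(b ^ (p ^ (k - 1)))²` agree modulo `p ^ k`, and the exponent is odd. -/
theorem exists_sq_eq_of_reduction_eq_sq (hp2 : p ≠ 2) (hk : 1 ≤ k) {a b : ZMod (p ^ k)}
    (ha : IsUnit a) (h : reduction p hk a = reduction p hk b ^ 2) : ∃ c, c ^ 2 = a := by
  have hdvd : (p : ZMod (p ^ k)) ∣ a - b ^ 2 := by
    rw [← pow_one (p : ZMod (p ^ k)), ← reduction_eq_zero_iff hk, map_sub, map_pow, h, sub_self]
  have h1 := dvd_sub_pow_of_dvd_sub hdvd (k - 1)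
  rw [Nat.sub_add_cancel hk, ← Nat.cast_pow, ZMod.natCast_self, zero_dvd_iff, sub_eq_zero] at h1
  obtain ⟨m, hm⟩ := (hp.out.odd_of_ne_two hp2).pow (n := k - 1)
  obtain ⟨i, hi⟩ := (ha.pow m).exists_right_inv
  refine ⟨b ^ p ^ (k - 1) * i, ?_⟩
  have h2 : (b ^ p ^ (k - 1)) ^ 2 = a * (a ^ m) ^ 2 := by
    rw [← pow_mul, mul_comm, pow_mul, ← h1, hm]
    ring
  rw [mul_pow, h2]
  linear_combination (a * (a ^ m * i + 1)) * hi

/-- A unit modulo an odd prime power has no square root, or exactly two. -/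
theorem card_sqrt_eq_two (hp2 : p ≠ 2) (hk : 1 ≤ k) {c : ZMod (p ^ k)} (hc : IsUnit c) :
    Nat.card {z : ZMod (p ^ k) // z ^ 2 = c ^ 2} = 2 := by
  have hne : c ≠ -c := by
    intro h
    have h0 : 2 * c = 0 := by linear_combination h
    have hu := (isUnit_two_zmod_prime_pow (k := k) hp2).mul hc
    rw [isUnit_iff_reduction_ne_zero hk, h0, map_zero] at hu
    exact hu rfl
  have hset : {z : ZMod (p ^ k) | z ^ 2 = c ^ 2} = {c, -c} := by
    ext z
    simp only [Set.mem_ofPred_eq, Set.mem_insert_iff, Set.mem_singleton_iff]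
    constructor
    · intro hz
      have hprod : (z - c) * (z + c) = 0 := by linear_combination hz
      by_cases hu : IsUnit (z + c)
      · left
        exact sub_eq_zero.1 ((hu.mul_left_eq_zero).1 hprod)
      · right
        rw [isUnit_iff_reduction_ne_zero hk, not_not, map_add] at hu
        have hu' : IsUnit (z - c) := by
          have h2c := (isUnit_two_zmod_prime_pow (k := k) hp2).mul hc
          rw [isUnit_iff_reduction_ne_zero hk] at h2c ⊢
          intro h0
          apply h2c
          rw [map_sub] at h0
          rw [map_mul, map_ofNat]
          linear_combination hu - h0
        exact eq_neg_of_add_eq_zero_left ((hu'.mul_right_eq_zero).1 hprod)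
    · rintro (rfl | rfl) <;> ring
  have : Nat.card ({c, -c} : Set (ZMod (p ^ k))) = 2 := by
    rw [Nat.card_coe_set_eq, Set.ncard_pair hne]
  rw [← hset] at this
  exact this

/-- For `t ≡ 1` modulo `p`, the equation `2 z² = t` is solvable exactly when `2` is a square modulo
`p`, and then has two solutions. -/
theorem card_sqrt_half (hp2 : p ≠ 2) (hk : 1 ≤ k) {t : ZMod (p ^ k)}
    (ht : reduction p hk t = 1) :
    (Nat.card {z : ZMod (p ^ k) // 2 * z ^ 2 = t} : ℝ) = 1 + chi p := by
  have hmod : p % 2 = 1 := hp.out.eq_two_or_odd.resolve_left hp2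
  obtain ⟨w, hw⟩ := (isUnit_two_zmod_prime_pow (k := k) hp2).exists_right_inv
  have htu : IsUnit t := by
    rw [isUnit_iff_reduction_ne_zero hk, ht]
    intro h
    rw [← Nat.cast_one (R := ZMod (p ^ 1)), ZMod.natCast_eq_zero_iff, pow_one] at h
    exact hp.out.one_lt.ne' (Nat.dvd_one.1 h)
  have hwu : IsUnit w := IsUnit.of_mul_eq_one 2 (by rw [mul_comm]; exact hw)
  have hwπ : 2 * reduction p hk w = 1 := by
    have := congrArg (reduction p hk) hw
    rwa [map_mul, map_ofNat, map_one] at this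
  have hiff : ∀ z : ZMod (p ^ k), 2 * z ^ 2 = t ↔ z ^ 2 = t * w := fun z =>
    ⟨fun h => by linear_combination w * h - z ^ 2 * hw,
      fun h => by linear_combination 2 * h + t * hw⟩
  have hsq' : IsSquare (2 : ZMod (p ^ 1)) ↔ p % 8 = 1 ∨ p % 8 = 7 := by
    rw [← ZMod.exists_sq_eq_two_iff hp2, pow_one]
  by_cases h8 : p % 8 = 1 ∨ p % 8 = 7
  · obtain ⟨s, hs⟩ := hsq'.2 h8
    obtain ⟨b, hb⟩ := reduction_surjective (p := p) hk (reduction p hk w * s)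
    obtain ⟨c, hc⟩ := exists_sq_eq_of_reduction_eq_sq hp2 hk (htu.mul hwu) (b := b) (by
      rw [map_mul, ht, hb]
      linear_combination (reduction p hk w) ^ 2 * hs - reduction p hk w * hwπ)
    have hcu : IsUnit c := by
      have := htu.mul hwu
      rw [← hc] at this
      exact (isUnit_pow_iff two_ne_zero).1 this
    have hcard := card_sqrt_eq_two hp2 hk hcu
    simp only [hiff, ← hc, hcard]
    rw [chi_eq, if_neg (by omega), if_pos h8]
    norm_num
  · have : IsEmpty {z : ZMod (p ^ k) // 2 * z ^ 2 = t} := by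
      refine ⟨fun ⟨z, hz⟩ => h8 (hsq'.1 ⟨2 * reduction p hk z, ?_⟩)⟩
      have := congrArg (reduction p hk) hz
      rw [map_mul, map_pow, map_ofNat, ht] at this
      linear_combination (-2) * this
    rw [Nat.card_of_isEmpty, chi_eq, if_neg (by omega), if_neg h8]
    norm_num

open Classical in
theorem card_isUnit_filter (hk : 1 ≤ k) :
    ((Finset.univ.filter fun u : ZMod (p ^ k) => IsUnit u).card : ℝ)
      = (p : ℝ) ^ (k - 1) * (p - 1) := by
  have h1 : (Finset.univ.filter fun u : ZMod (p ^ k) => IsUnit u).card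
      = Fintype.card (ZMod (p ^ k))ˣ := by
    rw [← Fintype.card_subtype]
    exact Fintype.card_congr (Equiv.ofBijective
      (fun u : (ZMod (p ^ k))ˣ => (⟨u, u.isUnit⟩ : {x : ZMod (p ^ k) // IsUnit x}))
      ⟨fun a b h => Units.ext (congrArg Subtype.val h), fun ⟨_, u, hu⟩ => ⟨u, Subtype.ext hu⟩⟩).symm
  rw [h1, ZMod.card_units_eq_totient, Nat.totient_prime_pow hp.out (by omega)]
  push_cast [Nat.cast_sub hp.out.one_le]
  ring

theorem card_subtype_prod_eq_sum {α β : Type*} [Finite α] [Fintype β] (P : β → α → Prop) :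
    Nat.card {x : β × α // P x.1 x.2} = ∑ b, Nat.card {a : α // P b a} := by
  rw [← Nat.card_sigma]
  exact Nat.card_congr (Equiv.subtypeProdEquivSigmaSubtype P)

/-- Over a ring in which `16` is invertible `f₁` becomes `u v + 2 z²`. -/
theorem card_points_f₁_eq {R : Type*} [CommRing R] (h16 : IsUnit (16 : R)) :
    Nat.card (points f₁ 1 R) = Nat.card {x : R × R × R // x.1 * x.2.1 + 2 * x.2.2 ^ 2 = 1} := by
  obtain ⟨w, hw⟩ := h16.exists_right_inv
  refine Nat.card_congr
    { toFun := fun x => ⟨(x.1 1 - x.1 0, 9 * x.1 0 + 7 * x.1 1, x.1 2), ?_⟩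
      invFun := fun y => ⟨![w * (y.1.2.1 - 7 * y.1.1), w * (y.1.2.1 + 9 * y.1.1), y.1.2.2], ?_⟩
      left_inv := ?_
      right_inv := ?_ }
  · have h : form f₁ x.1 = ((1 : ℤ) : R) := x.2
    rwa [form_f₁_eq, Int.cast_one] at h
  · have := y.2
    change form f₁ _ = ((1 : ℤ) : R)
    rw [form_f₁_eq, Int.cast_one]
    simp only [Matrix.cons_val_zero, Matrix.cons_val_one, Matrix.cons_val]
    linear_combination this + (16 * w + 1) * y.1.1 * y.1.2.1 * hw
  · intro x
    ext i
    fin_cases i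
    · change w * (9 * x.1 0 + 7 * x.1 1 - 7 * (x.1 1 - x.1 0)) = x.1 0
      linear_combination x.1 0 * hw
    · change w * (9 * x.1 0 + 7 * x.1 1 + 9 * (x.1 1 - x.1 0)) = x.1 1
      linear_combination x.1 1 * hw
    · rfl
  · intro y
    ext
    · change w * (y.1.2.1 + 9 * y.1.1) - w * (y.1.2.1 - 7 * y.1.1) = y.1.1
      linear_combination y.1.1 * hw
    · change 9 * (w * (y.1.2.1 - 7 * y.1.1)) + 7 * (w * (y.1.2.1 + 9 * y.1.1)) = y.1.2.1
      linear_combination y.1.2.1 * hw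
    · rfl

/-- A point `(u, v, z)` of `u v + 2 z² = 1` with `u` a unit is determined by `u` and `z`; if `u` is
not a unit then `u` and `v` are arbitrary and `z` is one of the `1 + χ₈(p)` roots of
`2 z² = 1 - u v`. -/
theorem densityRatio_f₁_of_odd (hp2 : p ≠ 2) (hk : 1 ≤ k) :
    densityRatio f₁ 1 p k = 1 + chi p / p := by
  classical
  have h16 : IsUnit (16 : ZMod (p ^ k)) := by
    have := (isUnit_two_zmod_prime_pow (k := k) hp2).pow 4
    norm_num at this
    exact this
  have hunit : ∀ u : ZMod (p ^ k), IsUnit u →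
      (Nat.card {x : ZMod (p ^ k) × ZMod (p ^ k) // u * x.1 + 2 * x.2 ^ 2 = 1} : ℝ) = p ^ k := by
    intro u hu
    obtain ⟨i, hi⟩ := hu.exists_right_inv
    have e : {x : ZMod (p ^ k) × ZMod (p ^ k) // u * x.1 + 2 * x.2 ^ 2 = 1} ≃ ZMod (p ^ k) :=
      { toFun := fun x => x.1.2
        invFun := fun z => ⟨(i * (1 - 2 * z ^ 2), z), by linear_combination (1 - 2 * z ^ 2) * hi⟩
        left_inv := fun x => by
          ext
          · change i * (1 - 2 * x.1.2 ^ 2) = x.1.1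
            linear_combination (-i) * x.2 + x.1.1 * hi
          · rfl
        right_inv := fun z => rfl }
    rw [Nat.card_congr e, Nat.card_zmod]
    push_cast
    rfl
  have hnonunit : ∀ u : ZMod (p ^ k), ¬ IsUnit u →
      (Nat.card {x : ZMod (p ^ k) × ZMod (p ^ k) // u * x.1 + 2 * x.2 ^ 2 = 1} : ℝ)
        = p ^ k * (1 + chi p) := by
    intro u hu
    rw [isUnit_iff_reduction_ne_zero hk, not_not] at hu
    rw [card_subtype_prod_eq_sum (fun v z => u * v + 2 * z ^ 2 = 1), Nat.cast_sum]
    have : ∀ v : ZMod (p ^ k), (Nat.card {z // u * v + 2 * z ^ 2 = 1} : ℝ) = 1 + chi p := by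
      intro v
      simp only [← eq_sub_iff_add_eq']
      exact card_sqrt_half hp2 hk (by rw [map_sub, map_mul, hu, map_one, zero_mul, sub_zero])
    simp only [this, Finset.sum_const, Finset.card_univ, ZMod.card, nsmul_eq_mul]
    push_cast
    rfl
  have hcount : (Nat.card (points f₁ 1 (ZMod (p ^ k))) : ℝ)
      = (p : ℝ) ^ (k - 1) * (p - 1) * p ^ k
        + (p ^ k - (p : ℝ) ^ (k - 1) * (p - 1)) * (p ^ k * (1 + chi p)) := by
    rw [card_points_f₁_eq h16, card_subtype_prod_eq_sum
      (fun u (y : ZMod (p ^ k) × ZMod (p ^ k)) => u * y.1 + 2 * y.2 ^ 2 = 1), Nat.cast_sum,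
      ← Finset.sum_filter_add_sum_filter_not _ (fun u => IsUnit u),
      Finset.sum_congr rfl (fun u hu => hunit u (Finset.mem_filter.1 hu).2),
      Finset.sum_congr rfl (fun u hu => hnonunit u (Finset.mem_filter.1 hu).2)]
    have hadd := Finset.card_filter_add_card_filter_not (s := Finset.univ)
      (fun u : ZMod (p ^ k) => IsUnit u)
    rw [Finset.card_univ, ZMod.card] at hadd
    have hadd' : ((Finset.univ.filter fun u : ZMod (p ^ k) => ¬ IsUnit u).card : ℝ)
        = p ^ k - (p : ℝ) ^ (k - 1) * (p - 1) := by
      rw [← card_isUnit_filter hk, eq_sub_iff_add_eq']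
      exact_mod_cast hadd
    rw [Finset.sum_const, Finset.sum_const, nsmul_eq_mul, nsmul_eq_mul, hadd',
      card_isUnit_filter hk]
  have hp0 : (p : ℝ) ≠ 0 := by exact_mod_cast hp.out.ne_zero
  obtain ⟨m, rfl⟩ : ∃ m, k = m + 1 := ⟨k - 1, by omega⟩
  rw [densityRatio, hcount, Nat.add_sub_cancel]
  field_simp
  ring

end PrimePower


/-! ### The local density at `2` -/

/-- Each fibre of reduction modulo `p ^ l` has `p ^ (k - l)` elements. -/
theorem card_reduction_ker {p l k : ℕ} [hp : Fact p.Prime] (h : l ≤ k) :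
    Nat.card (reduction p h).toAddMonoidHom.ker = p ^ (k - l) := by
  have h1 := AddSubgroup.card_mul_index (reduction p h).toAddMonoidHom.ker
  have h2 : (reduction p h).toAddMonoidHom.range = ⊤ :=
    AddMonoidHom.range_eq_top.2 (reduction_surjective h)
  rw [AddSubgroup.index_ker, h2, AddSubgroup.card_top, Nat.card_zmod, Nat.card_zmod] at h1
  refine Nat.eq_of_mul_eq_mul_right (pow_pos hp.out.pos l) ?_
  rw [h1, ← pow_add, Nat.sub_add_cancel h]

theorem sum_comp_reduction {p l k : ℕ} [hp : Fact p.Prime] (h : l ≤ k)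
    (g : ZMod (p ^ l) → ℕ) :
    ∑ u, g (reduction p h u) = p ^ (k - l) * ∑ a, g a := by
  classical
  rw [Finset.sum_comp, Finset.image_univ_of_surjective (reduction_surjective h), Finset.mul_sum]
  refine Finset.sum_congr rfl fun a _ => ?_
  have hfib := AddMonoidHom.card_fiber_eq_of_mem_range (reduction p h).toAddMonoidHom
    (x := a) (y := 0) (reduction_surjective h a) ⟨0, map_zero _⟩
  have hker : (Finset.univ.filter fun u => reduction p h u = 0).card = p ^ (k - l) := by
    rw [← card_reduction_ker h, ← Fintype.card_subtype, ← Nat.card_eq_fintype_card]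
    rfl
  rw [smul_eq_mul, ← hker]
  exact congrArg (· * g a) hfib

theorem sum_sum_comp_reduction {p l k : ℕ} [hp : Fact p.Prime] (h : l ≤ k)
    (g : ZMod (p ^ l) → ZMod (p ^ l) → ℕ) :
    ∑ u, ∑ z, g (reduction p h u) (reduction p h z) = (p ^ (k - l)) ^ 2 * ∑ a, ∑ b, g a b := by
  simp only [sum_comp_reduction h (g _)]
  rw [sum_comp_reduction h (fun a => p ^ (k - l) * ∑ b, g a b), ← Finset.mul_sum]
  ring

/-- Multiplication by `p ^ l` on `ℤ/p^k` has a kernel of `p ^ l` elements, since its range is the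
kernel of reduction modulo `p ^ l`. -/
theorem card_pow_mul_eq_zero {p l k : ℕ} [hp : Fact p.Prime] (h : l ≤ k) :
    Nat.card {x : ZMod (p ^ k) // (p : ZMod (p ^ k)) ^ l * x = 0} = p ^ l := by
  let f : ZMod (p ^ k) →+ ZMod (p ^ k) := AddMonoidHom.mulLeft ((p : ZMod (p ^ k)) ^ l)
  have h1 := AddSubgroup.card_mul_index f.ker
  have h2 : f.range = (reduction p h).toAddMonoidHom.ker := by
    ext a
    change (∃ x, (p : ZMod (p ^ k)) ^ l * x = a) ↔ reduction p h a = 0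
    rw [reduction_eq_zero_iff h]
    exact ⟨fun ⟨x, hx⟩ => ⟨x, hx.symm⟩, fun ⟨x, hx⟩ => ⟨x, hx.symm⟩⟩
  rw [AddSubgroup.index_ker, h2, card_reduction_ker h, Nat.card_zmod] at h1
  refine Nat.eq_of_mul_eq_mul_right (pow_pos hp.out.pos (k - l)) ?_
  rw [← pow_add, Nat.add_sub_cancel' h]
  exact h1

theorem card_pow_mul_eq {p l k : ℕ} [hp : Fact p.Prime] (h : l ≤ k) (c : ZMod (p ^ k))
    [Decidable (reduction p h c = 0)] :
    Nat.card {x : ZMod (p ^ k) // (p : ZMod (p ^ k)) ^ l * x = c}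
      = if reduction p h c = 0 then p ^ l else 0 := by
  split_ifs with hc
  · rw [reduction_eq_zero_iff h] at hc
    obtain ⟨y, rfl⟩ := hc
    rw [← card_pow_mul_eq_zero h]
    refine Nat.card_congr ((Equiv.subRight y).subtypeEquiv fun x => ?_)
    rw [Equiv.subRight_apply, mul_sub, sub_eq_zero]
  · have : IsEmpty {x : ZMod (p ^ k) // (p : ZMod (p ^ k)) ^ l * x = c} :=
      ⟨fun ⟨x, hx⟩ => hc ((reduction_eq_zero_iff h).2 ⟨x, hx.symm⟩)⟩
    exact Nat.card_of_isEmpty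

/-- The points of `f₁ = 1` over a finite ring in the coordinates `(u, z, x)`, `u = y - x`, which do
not require `2` to be invertible. -/
theorem card_points_f₁_eq_sum {R : Type*} [CommRing R] [Fintype R] :
    Nat.card (points f₁ 1 R)
      = ∑ u : R, ∑ z : R, Nat.card {x : R // u * (7 * u + 16 * x) + 2 * z ^ 2 = 1} := by
  have e : points f₁ 1 R ≃ {x : R × R × R // x.1 * (7 * x.1 + 16 * x.2.2) + 2 * x.2.1 ^ 2 = 1} :=
    { toFun := fun x => ⟨(x.1 1 - x.1 0, x.1 2, x.1 0), by
        have h : form f₁ x.1 = ((1 : ℤ) : R) := x.2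
        rw [form_f₁_eq, Int.cast_one] at h
        linear_combination h⟩
      invFun := fun y => ⟨![y.1.2.2, y.1.1 + y.1.2.2, y.1.2.1], by
        change form f₁ _ = ((1 : ℤ) : R)
        rw [form_f₁_eq, Int.cast_one]
        simp only [Matrix.cons_val_zero, Matrix.cons_val_one, Matrix.cons_val]
        linear_combination y.2⟩
      left_inv := fun x => by
        ext i
        fin_cases i
        · rfl
        · exact sub_add_cancel _ _
        · rfl
      right_inv := fun y => by
        ext
        · exact add_sub_cancel_right _ _
        · rfl
        · rfl }
  rw [Nat.card_congr e, card_subtype_prod_eq_sum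
    (fun u (y : R × R) => u * (7 * u + 16 * y.2) + 2 * y.1 ^ 2 = 1)]
  exact Finset.sum_congr rfl fun u _ =>
    card_subtype_prod_eq_sum (fun z x => u * (7 * u + 16 * x) + 2 * z ^ 2 = 1)

theorem sum_solutions_zmod_sixteen :
    ∑ a : ZMod 16, ∑ b : ZMod 16, (if 7 * a ^ 2 + 2 * b ^ 2 = 1 then 16 else 0) = 512 := by
  decide +kernel

/-- The same count for a modulus, such as `2 ^ 4`, that is only propositionally equal to `16`. -/
theorem sum_solutions_mod_sixteen {n : ℕ} [NeZero n] (hn : n = 16) :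
    ∑ a : ZMod n, ∑ b : ZMod n, (if 7 * a ^ 2 + 2 * b ^ 2 = 1 then 16 else 0) = 512 := by
  subst hn
  exact sum_solutions_zmod_sixteen

/-- Modulo `2 ^ k` with `k ≥ 4`, a point `7 u² + 16 u x + 2 z² = 1` has `u` odd, so `x` can be
solved for, in `16` ways, exactly when `7 u² + 2 z² ≡ 1` modulo `16`; that congruence has `32`
solutions modulo `16`. -/
theorem densityRatio_f₁_two {k : ℕ} (hk : 4 ≤ k) : densityRatio f₁ 1 2 k = 2 := by
  have h01 : (0 : ZMod (2 ^ 1)) ≠ 1 := by decide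
  have := Fact.mk Nat.prime_two
  have hinner : ∀ u z : ZMod (2 ^ k),
      Nat.card {x : ZMod (2 ^ k) // u * (7 * u + 16 * x) + 2 * z ^ 2 = 1}
        = if 7 * reduction 2 hk u ^ 2 + 2 * reduction 2 hk z ^ 2 = 1 then 16 else 0 := by
    intro u z
    by_cases hu : IsUnit u
    · obtain ⟨i, hi⟩ := hu.exists_right_inv
      have hiff : ∀ x : ZMod (2 ^ k), u * (7 * u + 16 * x) + 2 * z ^ 2 = 1 ↔
          ((2 : ℕ) : ZMod (2 ^ k)) ^ 4 * x = i * (1 - 7 * u ^ 2 - 2 * z ^ 2) := by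
        intro x
        push_cast
        constructor
        · intro h
          linear_combination i * h - 16 * x * hi
        · intro h
          linear_combination u * h + (1 - 7 * u ^ 2 - 2 * z ^ 2) * hi
      simp only [hiff]
      rw [card_pow_mul_eq hk]
      have hπ : reduction 2 hk u * reduction 2 hk i = 1 := by
        rw [← map_mul, hi, map_one]
      have : reduction 2 hk (i * (1 - 7 * u ^ 2 - 2 * z ^ 2)) = 0 ↔
          7 * reduction 2 hk u ^ 2 + 2 * reduction 2 hk z ^ 2 = 1 := by
        simp only [map_mul, map_sub, map_one, map_pow, map_ofNat]
        constructor
        · intro h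
          linear_combination (-reduction 2 hk u) * h + (1 - 7 * reduction 2 hk u ^ 2 -
            2 * reduction 2 hk z ^ 2) * hπ
        · intro h
          linear_combination (-reduction 2 hk i) * h
      simp only [this]
      norm_num
    · rw [isUnit_iff_reduction_ne_zero (by omega : 1 ≤ k), not_not] at hu
      have hempty : IsEmpty {x : ZMod (2 ^ k) // u * (7 * u + 16 * x) + 2 * z ^ 2 = 1} := by
        refine ⟨fun ⟨x, hx⟩ => ?_⟩
        have h := congrArg (reduction 2 (by omega : 1 ≤ k)) hx
        rw [map_add, map_mul, hu, zero_mul, zero_add, map_mul, map_ofNat, map_one,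
          show (2 : ZMod (2 ^ 1)) = 0 from rfl, zero_mul] at h
        exact h01 h
      rw [Nat.card_of_isEmpty, if_neg]
      intro h
      obtain ⟨w, rfl⟩ := (reduction_eq_zero_iff (by omega : 1 ≤ k)).1 hu
      rw [pow_one, map_mul, map_natCast] at h
      push_cast at h
      have h16 : (16 : ZMod (2 ^ 4)) = 0 := rfl
      have h8 : (8 : ZMod (2 ^ 4)) = 0 := by
        linear_combination (-8) * h +
          (14 * reduction 2 hk w ^ 2 + reduction 2 hk z ^ 2) * h16
      exact absurd h8 (by decide)
  have hcard : Nat.card (points f₁ 1 (ZMod (2 ^ k))) = (2 ^ (k - 4)) ^ 2 * 512 := by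
    rw [card_points_f₁_eq_sum, ← sum_solutions_mod_sixteen (n := 2 ^ 4) (by norm_num),
      ← sum_sum_comp_reduction hk (fun a b => if 7 * a ^ 2 + 2 * b ^ 2 = 1 then 16 else 0)]
    exact Finset.sum_congr rfl fun u _ => Finset.sum_congr rfl fun z _ => hinner u z
  obtain ⟨m, rfl⟩ : ∃ m, k = m + 4 := ⟨k - 4, by omega⟩
  rw [densityRatio, hcard, Nat.add_sub_cancel]
  push_cast
  field_simp
  ring


/-! ### The singular integral -/

/-- The real quadratic function `f₁`. -/
noncomputable def realForm (x : Fin 3 → ℝ) : ℝ := form f₁ x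

theorem realForm_eq (x : Fin 3 → ℝ) :
    realForm x = (x 1 - x 0) * (9 * x 0 + 7 * x 1) + 2 * x 2 ^ 2 :=
  form_f₁_eq x

theorem continuous_realForm : Continuous realForm := by
  simp only [funext realForm_eq]
  fun_prop

theorem realForm_smul (r : ℝ) (x : Fin 3 → ℝ) : realForm (r • x) = r ^ 2 * realForm x := by
  simp only [realForm_eq, Pi.smul_apply, smul_eq_mul]
  ring

theorem continuous_quadraticForm (Q : QuadraticForm ℝ (Fin 3 → ℝ)) : Continuous Q := by
  let B : (Fin 3 → ℝ) →ₗ[ℝ] (Fin 3 → ℝ) →L[ℝ] ℝ :=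
    (LinearMap.toContinuousLinearMap (𝕜 := ℝ) (E := Fin 3 → ℝ) (F' := ℝ)).toLinearMap ∘ₗ
      QuadraticMap.associated Q
  have hB : Continuous fun x => B x x :=
    B.continuous_of_finiteDimensional.clm_apply continuous_id
  refine hB.congr fun x => ?_
  exact QuadraticMap.associated_eq_self_apply ℝ Q x

theorem quadraticForm_smul (Q : QuadraticForm ℝ (Fin 3 → ℝ)) (r : ℝ) (x : Fin 3 → ℝ) :
    Q (r • x) = r ^ 2 * Q x := by
  rw [QuadraticMap.map_smul, smul_eq_mul, pow_two]

/-- The zero set of a function which is a genuine quadratic polynomial on each line in some fixed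
direction is null. -/
theorem volume_zeroSet_eq_zero {g : (Fin 3 → ℝ) → ℝ} (hg : Continuous g) (e : Fin 3 → ℝ) {α : ℝ}
    (hα : α ≠ 0) (β γ : (Fin 3 → ℝ) → ℝ)
    (h : ∀ y t, g (y + t • e) = α * t ^ 2 + β y * t + γ y) : volume {x | g x = 0} = 0 := by
  have hmeas : MeasurableSet {x | g x = 0}ᶜ :=
    (isClosed_eq hg continuous_const).measurableSet.compl
  have hae := ae_mem_of_ae_add_linearMap_mem (LinearMap.toSpanSingleton ℝ _ e)
    (volume : Measure ℝ) (volume : Measure (Fin 3 → ℝ)) hmeas (fun y => by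
      let P : Polynomial ℝ := .C α * .X ^ 2 + .C (β y) * .X + .C (γ y)
      have hP : P ≠ 0 := by
        intro h0
        have := congrArg (fun p => Polynomial.coeff p 2) h0
        simp [P] at this
        exact hα this
      have hfin : {t : ℝ | P.IsRoot t}.Finite := Polynomial.finite_setOfPred_isRoot hP
      have hnull : volume {t : ℝ | P.IsRoot t} = 0 := hfin.measure_zero _
      filter_upwards [measure_eq_zero_iff_ae_notMem.1 hnull] with t ht hmem
      apply ht
      have hmem' : g (y + t • e) = 0 := hmem
      rw [h] at hmem'
      simpa [P, Polynomial.IsRoot] using hmem')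
  exact measure_eq_zero_iff_ae_notMem.2 hae

theorem realForm_line (y : Fin 3 → ℝ) (t : ℝ) : realForm (y + t • ![1, 0, 0])
    = -9 * t ^ 2 + (2 * y 1 - 18 * y 0) * t + realForm y := by
  simp only [realForm_eq, Pi.add_apply, Pi.smul_apply, smul_eq_mul, Matrix.cons_val_zero,
    Matrix.cons_val_one, Matrix.cons_val]
  ring

theorem volume_realForm_eq (c : ℝ) : volume {x | realForm x = c} = 0 := by
  have := volume_zeroSet_eq_zero (g := fun x => realForm x - c)
    (continuous_realForm.sub continuous_const) ![1, 0, 0] (by norm_num : (-9 : ℝ) ≠ 0)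
    (fun y => 2 * y 1 - 18 * y 0) (fun y => realForm y - c)
    (fun y t => by rw [realForm_line]; ring)
  simpa only [sub_eq_zero] using this

section PosDef

variable {Q : QuadraticForm ℝ (Fin 3 → ℝ)} (hQ : Q.PosDef)

include hQ

theorem volume_quadraticForm_eq_mul_realForm {c : ℝ} (hc : 0 < c) :
    volume {x | Q x = c * realForm x} = 0 := by
  have he : 0 < Q ![1, 0, 0] := hQ _ fun h => one_ne_zero (congrFun h 0)
  have := volume_zeroSet_eq_zero (g := fun x => Q x - c * realForm x)
    ((continuous_quadraticForm Q).sub (continuous_const.mul continuous_realForm)) ![1, 0, 0]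
    (by positivity : Q ![1, 0, 0] + 9 * c ≠ 0)
    (fun y => QuadraticMap.polar Q y ![1, 0, 0] - c * (2 * y 1 - 18 * y 0))
    (fun y => Q y - c * realForm y)
    (fun y t => by
      rw [realForm_line, QuadraticMap.map_add Q, quadraticForm_smul, QuadraticMap.polar_smul_right,
        smul_eq_mul]
      ring)
  simpa only [sub_eq_zero] using this

theorem volume_quadraticForm_le_lt_top (c : ℝ) : volume {x | Q x ≤ c} < ⊤ := by
  obtain ⟨x₀, hx₀, hmin⟩ := (isCompact_sphere (0 : Fin 3 → ℝ) 1).exists_isMinOn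
    (NormedSpace.sphere_nonempty.2 zero_le_one) (continuous_quadraticForm Q).continuousOn
  have hm : 0 < Q x₀ := hQ _ (ne_zero_of_mem_unit_sphere ⟨x₀, hx₀⟩)
  have hbound : ∀ x, Q x₀ * ‖x‖ ^ 2 ≤ Q x := by
    intro x
    rcases eq_or_ne x 0 with rfl | hx
    · simp
    · have hx' : 0 < ‖x‖ := norm_pos_iff.2 hx
      have h1 : ‖x‖⁻¹ • x ∈ Metric.sphere (0 : Fin 3 → ℝ) 1 := by
        rw [mem_sphere_zero_iff_norm, norm_smul, norm_inv, norm_norm, inv_mul_cancel₀ hx'.ne']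
      have h2 : Q x₀ ≤ Q (‖x‖⁻¹ • x) := hmin h1
      rw [quadraticForm_smul, inv_pow, ← div_eq_inv_mul, le_div_iff₀ (by positivity)] at h2
      exact h2
  refine (measure_mono (t := Metric.closedBall 0 √(c / Q x₀)) ?_).trans_lt
    measure_closedBall_lt_top
  intro x hx
  have hx' : Q x ≤ c := hx
  rw [mem_closedBall_zero_iff]
  refine Real.le_sqrt_of_sq_le ?_
  rw [le_div_iff₀ hm, mul_comm]
  exact (hbound x).trans hx'

omit hQ

/-- The part of the cone over `{f₁ = 1, Q ≤ c}` lying in `0 < f₁ ≤ s`. -/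
def coneRegion (Q : QuadraticForm ℝ (Fin 3 → ℝ)) (c s : ℝ) : Set (Fin 3 → ℝ) :=
  {x | 0 < realForm x ∧ realForm x ≤ s ∧ Q x ≤ c * realForm x}

theorem measurableSet_coneRegion (c s : ℝ) : MeasurableSet (coneRegion Q c s) :=
  ((isOpen_lt continuous_const continuous_realForm).measurableSet.inter
    ((isClosed_le continuous_realForm continuous_const).measurableSet.inter
      (isClosed_le (continuous_quadraticForm Q)
        (continuous_const.mul continuous_realForm)).measurableSet))

theorem coneRegion_mono_left {c d : ℝ} (h : c ≤ d) (s : ℝ) :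
    coneRegion Q c s ⊆ coneRegion Q d s := fun _ hx =>
  ⟨hx.1, hx.2.1, hx.2.2.trans (mul_le_mul_of_nonneg_right h hx.1.le)⟩

/-- The volume of the cone over `{f₁ = 1, Q ≤ c}`. -/
noncomputable def coneVolume (Q : QuadraticForm ℝ (Fin 3 → ℝ)) (c : ℝ) : ℝ :=
  volume.real (coneRegion Q c 1)

open scoped Pointwise in
theorem coneRegion_eq_smul (c : ℝ) {s : ℝ} (hs : 0 < s) :
    coneRegion Q c s = √s • coneRegion Q c 1 := by
  have h0 : √s ≠ 0 := (Real.sqrt_pos.2 hs).ne'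
  ext x
  rw [Set.mem_smul_set_iff_inv_smul_mem₀ h0]
  simp only [coneRegion, Set.mem_ofPred_eq, realForm_smul, quadraticForm_smul, inv_pow,
    Real.sq_sqrt hs.le]
  have h1 : s⁻¹ * realForm x ≤ 1 ↔ realForm x ≤ s := by
    rw [← div_eq_inv_mul, div_le_one hs]
  have h2 : s⁻¹ * Q x ≤ c * (s⁻¹ * realForm x) ↔ Q x ≤ c * realForm x := by
    rw [mul_left_comm]
    exact mul_le_mul_iff_right₀ (inv_pos.2 hs)
  rw [h1, h2, mul_pos_iff_of_pos_left (inv_pos.2 hs)]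

theorem volume_coneRegion (c : ℝ) {s : ℝ} (hs : 0 < s) :
    volume.real (coneRegion Q c s) = √s ^ 3 * coneVolume Q c := by
  rw [coneRegion_eq_smul c hs, Measure.real, Measure.addHaar_smul, ENNReal.toReal_mul,
    ENNReal.toReal_ofReal (abs_nonneg _), abs_of_nonneg (by positivity), coneVolume,
    Module.finrank_fin_fun]
  rfl

include hQ

theorem volume_coneRegion_ne_top {c : ℝ} (hc : 0 ≤ c) (s : ℝ) :
    volume (coneRegion Q c s) ≠ ⊤ := by
  refine ((measure_mono fun x hx => ?_).trans_lt (volume_quadraticForm_le_lt_top hQ (c * s))).ne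
  exact hx.2.2.trans (mul_le_mul_of_nonneg_left hx.2.1 hc)

theorem continuousAt_coneVolume {c : ℝ} (hc : 0 < c) : ContinuousAt (coneVolume Q) c := by
  have hB := volume_coneRegion_ne_top hQ (by positivity : 0 ≤ c + 1) 1
  have hlim := tendsto_measure_of_ae_tendsto_indicator (μ := volume) (𝓝 c)
    (measurableSet_coneRegion (Q := Q) c 1) (fun d => measurableSet_coneRegion (Q := Q) d 1)
    (measurableSet_coneRegion (c + 1) 1) hB ?_ ?_
  · exact (ENNReal.tendsto_toReal (volume_coneRegion_ne_top hQ hc.le 1)).comp hlim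
  · filter_upwards [eventually_le_nhds (lt_add_one c)] with d hd using coneRegion_mono_left hd 1
  · filter_upwards [measure_eq_zero_iff_ae_notMem.1
      (volume_quadraticForm_eq_mul_realForm hQ hc)] with x hx
    have hcont : ContinuousAt (fun d : ℝ => d * realForm x) c := by fun_prop
    rcases lt_or_gt_of_ne (show Q x ≠ c * realForm x from hx) with h | h
    · filter_upwards [hcont.eventually (lt_mem_nhds h)] with d hd
      simp only [coneRegion, Set.mem_ofPred_eq, hd.le, h.le]
    · filter_upwards [hcont.eventually (gt_mem_nhds h)] with d hd
      simp only [coneRegion, Set.mem_ofPred_eq, not_le.2 hd, not_le.2 h]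

theorem volume_coneRegion_diff {c a b : ℝ} (hc : 0 ≤ c) (ha : 0 < a) (hab : a ≤ b) :
    volume.real (coneRegion Q c b \ coneRegion Q c a) = (√b ^ 3 - √a ^ 3) * coneVolume Q c := by
  have hsub : coneRegion Q c a ⊆ coneRegion Q c b :=
    fun x hx => ⟨hx.1, hx.2.1.trans hab, hx.2.2⟩
  rw [measureReal_sdiff hsub (measurableSet_coneRegion c a) (volume_coneRegion_ne_top hQ hc b),
    volume_coneRegion c (ha.trans_le hab), volume_coneRegion c ha, sub_mul]

/-- The slab `|f₁ - 1| < ε / 2` of the ball of radius `T` lies between the slabs of the cones over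
`{f₁ = 1, Q ≤ T² / (1 ± ε / 2)}`. -/
theorem volumeRatio_mem_Icc {T ε : ℝ} (hT : 0 < T) (hε : 0 < ε) (hε2 : ε < 2) :
    volumeRatio f₁ 1 Q T ε ∈ Set.Icc
      ((√(1 + ε / 2) ^ 3 - √(1 - ε / 2) ^ 3) / ε * coneVolume Q (T ^ 2 / (1 + ε / 2)))
      ((√(1 + ε / 2) ^ 3 - √(1 - ε / 2) ^ 3) / ε * coneVolume Q (T ^ 2 / (1 - ε / 2))) := by
  have ha : 0 < 1 - ε / 2 := by linarith
  have hb : 0 < 1 + ε / 2 := by linarith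
  have hab : 1 - ε / 2 ≤ 1 + ε / 2 := by linarith
  have hset : {x : Fin 3 → ℝ | euclNorm Q x ≤ T ∧ |form f₁ x - ((1 : ℤ) : ℝ)| < ε / 2}
      = {x | Q x ≤ T ^ 2 ∧ 1 - ε / 2 < realForm x ∧ realForm x < 1 + ε / 2} := by
    ext x
    simp only [Set.mem_ofPred_eq, euclNorm, Real.sqrt_le_left hT.le, Int.cast_one, realForm, abs_lt]
    refine and_congr Iff.rfl (and_congr ?_ ?_) <;> constructor <;> intro h <;> linarith
  rw [volumeRatio, hset, div_mul_eq_mul_div, div_mul_eq_mul_div,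
    ← volume_coneRegion_diff hQ (by positivity) ha hab,
    ← volume_coneRegion_diff hQ (by positivity) ha hab]
  constructor
  · refine div_le_div_of_nonneg_right ?_ hε.le
    have hfin : volume {x | Q x ≤ T ^ 2 ∧ 1 - ε / 2 < realForm x ∧ realForm x < 1 + ε / 2} ≠ ⊤ :=
      ne_top_of_le_ne_top (volume_quadraticForm_le_lt_top hQ (T ^ 2)).ne
        (measure_mono fun x hx => hx.1)
    refine ENNReal.toReal_mono hfin (measure_mono_ae ?_)
    -- the cone region contains its boundary `f₁ = 1 + ε / 2`, which the slab omits
    filter_upwards [measure_eq_zero_iff_ae_notMem.1 (volume_realForm_eq (1 + ε / 2))]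
      with x hx hmem
    obtain ⟨⟨h1, h2, h3⟩, h4⟩ := hmem
    refine ⟨?_, ?_, lt_of_le_of_ne h2 hx⟩
    · refine h3.trans ?_
      rw [div_mul_eq_mul_div, div_le_iff₀ hb]
      exact mul_le_mul_of_nonneg_left h2 (by positivity)
    · by_contra h
      exact h4 ⟨h1, not_lt.1 h, h3⟩
  · refine div_le_div_of_nonneg_right ?_ hε.le
    have hfin : volume (coneRegion Q (T ^ 2 / (1 - ε / 2)) (1 + ε / 2)) ≠ ⊤ :=
      volume_coneRegion_ne_top hQ (by positivity) _
    refine measureReal_mono ?_ (ne_top_of_le_ne_top hfin (measure_mono Set.sdiff_subset))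
    rintro x ⟨h1, h2, h3⟩
    refine ⟨⟨ha.trans h2, h3.le, h1.trans ?_⟩, fun h => h2.not_ge h.2.1⟩
    rw [div_mul_eq_mul_div, le_div_iff₀ ha]
    exact mul_le_mul_of_nonneg_left h2.le (by positivity)

omit hQ

theorem tendsto_sqrt_cube_slope :
    Tendsto (fun ε : ℝ => (√(1 + ε / 2) ^ 3 - √(1 - ε / 2) ^ 3) / ε) (𝓝[>] 0) (𝓝 (3 / 2)) := by
  have h1 : HasDerivAt (fun ε : ℝ => √(1 + ε / 2) ^ 3) (3 / 4) 0 := by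
    have := (((hasDerivAt_id (0 : ℝ)).div_const 2).const_add 1).sqrt (by simp)
    refine (this.fun_pow 3).congr_deriv ?_
    norm_num
  have h2 : HasDerivAt (fun ε : ℝ => √(1 - ε / 2) ^ 3) (-(3 / 4)) 0 := by
    have := (((hasDerivAt_id (0 : ℝ)).div_const 2).const_sub 1).sqrt (by simp)
    refine (this.fun_pow 3).congr_deriv ?_
    norm_num
  have h3 := (h1.sub h2).tendsto_slope_zero_right
  norm_num at h3
  refine h3.congr fun ε => ?_
  ring_nf

include hQ

theorem tendsto_volumeRatio {T : ℝ} (hT : 0 < T) :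
    Tendsto (fun ε : ℝ => volumeRatio f₁ 1 Q T ε) (𝓝[>] 0) (𝓝 (3 / 2 * coneVolume Q (T ^ 2))) := by
  have hcone : ∀ σ : ℝ, Tendsto (fun ε : ℝ => coneVolume Q (T ^ 2 / (1 + σ * ε / 2))) (𝓝[>] 0)
      (𝓝 (coneVolume Q (T ^ 2))) := by
    intro σ
    refine (continuousAt_coneVolume hQ (by positivity)).tendsto.comp
      (tendsto_nhdsWithin_of_tendsto_nhds ?_)
    have : ContinuousAt (fun ε : ℝ => T ^ 2 / (1 + σ * ε / 2)) 0 := by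
      refine ContinuousAt.div (by fun_prop) (by fun_prop) (by simp)
    simpa [ContinuousAt] using this
  have hlow := tendsto_sqrt_cube_slope.mul (hcone 1)
  have hupp := tendsto_sqrt_cube_slope.mul (hcone (-1))
  have hev : ∀ᶠ ε : ℝ in 𝓝[>] 0, 0 < ε ∧ ε < 2 :=
    (eventually_mem_nhdsWithin).and (nhdsWithin_le_nhds (eventually_lt_nhds two_pos))
  refine tendsto_of_tendsto_of_tendsto_of_le_of_le' hlow hupp ?_ ?_
  · filter_upwards [hev] with ε hε
    simpa only [one_mul] using (volumeRatio_mem_Icc hQ hT hε.1 hε.2).1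
  · filter_upwards [hev] with ε hε
    simpa only [neg_mul, one_mul, neg_div, ← sub_eq_add_neg]
      using (volumeRatio_mem_Icc hQ hT hε.1 hε.2).2

theorem singularIntegral_f₁ {T : ℝ} (hT : 0 < T) :
    singularIntegral f₁ 1 Q T = 3 / 2 * coneVolume Q (T ^ 2) :=
  (tendsto_volumeRatio hQ hT).limUnder_eq

omit hQ

/-- The matrix of the isometry `(u, v, z) ↦ (2 u, v / 2, z)` of `u v + 2 z²`, where `u = y - x` and
`v = 9 x + 7 y`. -/
noncomputable def hyperbolicRotation : Matrix (Fin 3) (Fin 3) ℝ :=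
  !![37 / 32, -21 / 32, 0; -27 / 32, 43 / 32, 0; 0, 0, 1]

/-- The hyperbolic rotations carry the regions `0 < f₁ ≤ 1`, `u > 2 ^ n` onto each other; these
have empty intersection, so their common volume is not finite. -/
theorem volume_realForm_mem_Ioc : volume {x | 0 < realForm x ∧ realForm x ≤ 1} = ⊤ := by
  by_contra hfin
  let D : ℕ → Set (Fin 3 → ℝ) := fun n =>
    {x | (0 < realForm x ∧ realForm x ≤ 1) ∧ (2 : ℝ) ^ n < x 1 - x 0}
  have hD : ∀ n, MeasurableSet (D n) := fun n =>
    (((isOpen_lt continuous_const continuous_realForm).measurableSet.inter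
      (isClosed_le continuous_realForm continuous_const).measurableSet)).inter
      (isOpen_lt continuous_const ((continuous_apply 1).sub (continuous_apply 0))).measurableSet
  have hDfin : ∀ n, volume (D n) ≠ ⊤ := fun n =>
    ne_top_of_le_ne_top hfin (measure_mono fun x hx => hx.1)
  have hanti : Antitone D := fun m n hmn x hx =>
    ⟨hx.1, (pow_le_pow_right₀ one_le_two hmn).trans_lt hx.2⟩
  have hdet : LinearMap.det (Matrix.toLin' hyperbolicRotation) = 1 := by
    rw [LinearMap.det_toLin', Matrix.det_fin_three]
    simp [hyperbolicRotation]
    norm_num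
  have hcoord : ∀ x : Fin 3 → ℝ, Matrix.toLin' hyperbolicRotation x
      = ![(37 * x 0 - 21 * x 1) / 32, (-27 * x 0 + 43 * x 1) / 32, x 2] := by
    intro x
    rw [Matrix.toLin'_apply]
    ext i
    fin_cases i <;>
      simp [hyperbolicRotation, Matrix.mulVec, dotProduct, Fin.sum_univ_three] <;> ring
  have hpre : ∀ n, Matrix.toLin' hyperbolicRotation ⁻¹' D (n + 1) = D n := by
    intro n
    ext x
    have h1 : realForm (Matrix.toLin' hyperbolicRotation x) = realForm x := by
      rw [hcoord]
      simp only [realForm_eq, Matrix.cons_val_zero, Matrix.cons_val_one, Matrix.cons_val]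
      ring
    have h2 : Matrix.toLin' hyperbolicRotation x 1 - Matrix.toLin' hyperbolicRotation x 0
        = 2 * (x 1 - x 0) := by
      rw [hcoord]
      simp only [Matrix.cons_val_zero, Matrix.cons_val_one]
      ring
    simp only [D, Set.mem_preimage, Set.mem_ofPred_eq, h1, h2, pow_succ']
    rw [mul_lt_mul_iff_right₀ (two_pos : (0 : ℝ) < 2)]
  have hconst : ∀ n, volume (D n) = volume (D 0) := by
    intro n
    induction n with
    | zero => rfl
    | succ n ih =>
      rw [← ih, ← hpre n, Measure.addHaar_preimage_linearMap _ (by rw [hdet]; exact one_ne_zero),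
        hdet]
      simp
  have hInter : ⋂ n, D n = ∅ := by
    refine Set.eq_empty_of_forall_notMem fun x hx => ?_
    obtain ⟨n, hn⟩ := pow_unbounded_of_one_lt (x 1 - x 0) (one_lt_two (α := ℝ))
    exact (Set.mem_iInter.1 hx n).2.not_gt hn
  have hlim := tendsto_measure_iInter_atTop (μ := volume)
    (fun n => (hD n).nullMeasurableSet) hanti ⟨0, hDfin 0⟩
  have hzero : volume (D 0) = 0 := by
    rw [hInter, measure_empty] at hlim
    exact tendsto_nhds_unique (tendsto_const_nhds.congr fun n => (hconst n).symm) hlim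
  have hopen : IsOpen {x : Fin 3 → ℝ | (0 < realForm x ∧ realForm x < 1) ∧ 1 < x 1 - x 0} :=
    ((isOpen_lt continuous_const continuous_realForm).inter
      (isOpen_lt continuous_realForm continuous_const)).inter
      (isOpen_lt continuous_const ((continuous_apply 1).sub (continuous_apply 0)))
  -- the point with `u = 2`, `v = 1 / 4`, `z = 0`
  have hmem : (![-55 / 64, 73 / 64, 0] : Fin 3 → ℝ) ∈
      {x : Fin 3 → ℝ | (0 < realForm x ∧ realForm x < 1) ∧ 1 < x 1 - x 0} := by
    simp only [Set.mem_ofPred_eq, realForm_eq, Matrix.cons_val_zero, Matrix.cons_val_one,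
      Matrix.cons_val]
    norm_num
  refine (hopen.measure_pos volume ⟨_, hmem⟩).ne' (measure_mono_null ?_ hzero)
  rintro x ⟨⟨h1, h2⟩, h3⟩
  exact ⟨⟨h1, h2.le⟩, by simpa using h3⟩

include hQ

theorem tendsto_coneVolume_atTop : Tendsto (coneVolume Q) atTop atTop := by
  have hU : ⋃ n : ℕ, coneRegion Q n 1 = {x | 0 < realForm x ∧ realForm x ≤ 1} := by
    ext x
    simp only [Set.mem_iUnion, coneRegion, Set.mem_ofPred_eq]
    constructor
    · rintro ⟨n, h1, h2, -⟩
      exact ⟨h1, h2⟩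
    · rintro ⟨h1, h2⟩
      obtain ⟨n, hn⟩ := exists_nat_ge (Q x / realForm x)
      exact ⟨n, h1, h2, (div_le_iff₀ h1).1 hn⟩
  have hlim := tendsto_measure_iUnion_atTop (μ := volume) (s := fun n : ℕ => coneRegion Q n 1)
    fun m n hmn => coneRegion_mono_left (by exact_mod_cast hmn) 1
  rw [hU, volume_realForm_mem_Ioc] at hlim
  rw [tendsto_atTop]
  intro M
  obtain ⟨n, hn⟩ := (hlim.eventually (lt_mem_nhds (ENNReal.ofReal_lt_top (r := M)))).exists
  filter_upwards [eventually_ge_atTop (n : ℝ)] with c hc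
  have hc0 : (0 : ℝ) ≤ c := n.cast_nonneg.trans hc
  refine (ENNReal.ofReal_le_iff_le_toReal (volume_coneRegion_ne_top hQ hc0 1)).1 ?_
  exact hn.le.trans (measure_mono (coneRegion_mono_left hc 1))

theorem tendsto_singularIntegral_f₁_atTop :
    Tendsto (fun T : ℝ => singularIntegral f₁ 1 Q T) atTop atTop := by
  have h := ((tendsto_coneVolume_atTop hQ).comp (tendsto_pow_atTop two_ne_zero)).const_mul_atTop
    (by norm_num : (0 : ℝ) < 3 / 2)
  refine h.congr' ?_
  filter_upwards [eventually_gt_atTop 0] with T hT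
  exact (singularIntegral_f₁ hQ hT).symm

end PosDef


/-! ### The singular series and the asymptotic constant -/

theorem tendsto_densityRatio_f₁ {p : ℕ} (hp : p.Prime) :
    Tendsto (fun k : ℕ => densityRatio f₁ 1 p k) atTop
      (𝓝 (if p = 2 then 2 else 1 + chi p / p)) := by
  have := Fact.mk hp
  refine tendsto_const_nhds.congr' ?_
  filter_upwards [eventually_ge_atTop 4] with k hk
  split_ifs with h
  · subst h
    exact (densityRatio_f₁_two hk).symm
  · exact (densityRatio_f₁_of_odd h (by omega)).symm

theorem localDensity_f₁ {p : ℕ} (hp : p.Prime) :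
    localDensity f₁ 1 p = if p = 2 then 2 else 1 + chi p / p :=
  (tendsto_densityRatio_f₁ hp).limUnder_eq

theorem partialSeries_f₁ {n : ℕ} (hn : 3 ≤ n) :
    partialSeries f₁ 1 n = 2 * ∏ p ∈ Nat.primesBelow n, (1 + chi p / p) := by
  have h2 : 2 ∈ Nat.primesBelow n := Nat.mem_primesBelow.2 ⟨hn, Nat.prime_two⟩
  have hchi : chi 2 = 0 := by simp [chi_eq]
  rw [partialSeries, ← Finset.mul_prod_erase _ _ h2, ← Finset.mul_prod_erase _ _ h2,
    localDensity_f₁ Nat.prime_two, if_pos rfl, hchi, zero_div, add_zero, one_mul]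
  congr 1
  refine Finset.prod_congr rfl fun p hp => ?_
  rw [localDensity_f₁ (Nat.prime_of_mem_primesBelow (Finset.mem_of_mem_erase hp)),
    if_neg (Finset.ne_of_mem_erase hp)]

theorem tendsto_partialSeries_f₁ :
    Tendsto (partialSeries f₁ 1) atTop (𝓝 (singularSeries f₁ 1)) ∧ 0 < singularSeries f₁ 1 := by
  obtain ⟨l, hl, hlim⟩ := exists_pos_tendsto_prod_one_add_chi_div
  have h : Tendsto (partialSeries f₁ 1) atTop (𝓝 (2 * l)) := by
    refine (hlim.const_mul 2).congr' ?_
    filter_upwards [eventually_ge_atTop 3] with n hn using (partialSeries_f₁ hn).symm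
  have heq : singularSeries f₁ 1 = 2 * l := h.limUnder_eq
  rw [heq]
  exact ⟨h, by positivity⟩

theorem isAsymptoticConstant_f₁_iff {Q : QuadraticForm ℝ (Fin 3 → ℝ)}
    (h : Tendsto (fun T : ℝ => singularSeries f₁ 1 * singularIntegral f₁ 1 Q T) atTop atTop)
    (c : ℝ) : IsAsymptoticConstant f₁ 1 Q c ↔ c = 0 := by
  simp only [IsAsymptoticConstant, countingFunction_f₁, Nat.cast_zero, zero_sub]
  constructor
  · intro hc
    by_contra h0
    rw [isLittleO_neg_left, isLittleO_const_mul_left_iff h0] at hc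
    refine (isLittleO_irrefl ?_) hc
    exact (h.eventually_ne_atTop 0).frequently
  · rintro rfl
    simp only [zero_mul, neg_zero]
    exact isLittleO_zero _ _

end TernaryQuadric

theorem mainTheorem6 :
    -- `f₁` represents `1` over `ℝ` and over every `ℤ_p`, but not over `ℤ`
    TernaryQuadric.Represents TernaryQuadric.f₁ 1 ℝ ∧
    (∀ (p : ℕ) [Fact p.Prime], TernaryQuadric.Represents TernaryQuadric.f₁ 1 ℤ_[p]) ∧
    ¬ TernaryQuadric.Represents TernaryQuadric.f₁ 1 ℤ ∧
    -- the limits defining the local densities and the singular series exist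
    (∀ p : ℕ, p.Prime →
      Tendsto (fun k : ℕ => TernaryQuadric.densityRatio TernaryQuadric.f₁ 1 p k) atTop
        (𝓝 (TernaryQuadric.localDensity TernaryQuadric.f₁ 1 p))) ∧
    Tendsto (TernaryQuadric.partialSeries TernaryQuadric.f₁ 1) atTop
      (𝓝 (TernaryQuadric.singularSeries TernaryQuadric.f₁ 1)) ∧
    -- for every Euclidean norm on `ℝ³`
    (∀ Q : QuadraticForm ℝ (Fin 3 → ℝ), Q.PosDef →
      -- `N(T, X) = 0` for all `T > 0`
      (∀ T : ℝ, 0 < T → TernaryQuadric.countingFunction TernaryQuadric.f₁ 1 Q T = 0) ∧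
      -- the limit defining the singular integral exists
      (∀ T : ℝ, 0 < T →
        Tendsto (fun ε : ℝ => TernaryQuadric.volumeRatio TernaryQuadric.f₁ 1 Q T ε) (𝓝[>] 0)
          (𝓝 (TernaryQuadric.singularIntegral TernaryQuadric.f₁ 1 Q T))) ∧
      -- `𝔖(X) μ_∞(T, X) → ∞`
      Tendsto (fun T : ℝ => TernaryQuadric.singularSeries TernaryQuadric.f₁ 1 *
        TernaryQuadric.singularIntegral TernaryQuadric.f₁ 1 Q T) atTop atTop ∧
      -- `c_X` exists, is unique, and equals `0`
      (∀ c : ℝ, TernaryQuadric.IsAsymptoticConstant TernaryQuadric.f₁ 1 Q c ↔ c = 0)) := by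
  refine ⟨TernaryQuadric.represents_f₁_real, fun p _ => TernaryQuadric.represents_f₁_padicInt p,
    TernaryQuadric.not_represents_f₁_int, fun p hp => ?_,
    TernaryQuadric.tendsto_partialSeries_f₁.1, fun Q hQ => ?_⟩
  · rw [TernaryQuadric.localDensity_f₁ hp]
    exact TernaryQuadric.tendsto_densityRatio_f₁ hp
  · have hatTop := (TernaryQuadric.tendsto_singularIntegral_f₁_atTop hQ).const_mul_atTop
      TernaryQuadric.tendsto_partialSeries_f₁.2
    refine ⟨fun T _ => TernaryQuadric.countingFunction_f₁ Q T, fun T hT => ?_, hatTop,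
      TernaryQuadric.isAsymptoticConstant_f₁_iff hatTop⟩
    rw [TernaryQuadric.singularIntegral_f₁ hQ hT]
    exact TernaryQuadric.tendsto_volumeRatio hQ hT
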